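/- Let $\mathcal H$ be a real Hilbert space, $R:\mathcal H\to\,]-\infty,+\infty]$ proper, convex and lower semicontinuous, $F:\mathcal H\to\mathbb R$ convex and differentiable with $L$-Lipschitz gradient ($L>0$), $\Phi=F+R$, and assume $\operatorname{Argmin}\Phi\neq\emptyset$. For a sequence $(a_k)$ of inertial parameters and a step-size $\gamma>0$, let $x_0\in\mathcal H$ be arbitrary, $x_{-1}=x_0$, and iterate $$y_k=x_k+a_k(x_k-x_{k-1}),\qquad x_{k+1}=\operatorname{prox}_{\gamma R}\bigl(y_k-\gamma\nabla F(y_k)\bigr)\qquad(k\ge 0),$$ where $\operatorname{prox}_{\gamma R}(z)$ is the minimizer of $u\mapsto\gamma R(u)+\tfrac12\|u-z\|^2$. *FISTA-Mod* with parameters $p,q>0$, $r=4$ and initial value $t_0$ uses $t_k=\tfrac12\bigl(p+\sqrt{q+4t_{k-1}^2}\bigr)$ and $a_k=(t_{k-1}-1)/t_k$ for $k\ge1$. The *modified APG scheme* with $\tau=0$, parameter $\sigma\in\,]0,1]$, initial value $\theta_0\in\,]0,1]$ and $\gamma=1/L$ uses, for $k\ge 1$, $$\theta_k\ge 0\ \text{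 solving }\ \theta_k^2=(1-\sigma\theta_k)\,\theta_{k-1}^2,\qquad a_k=\frac{\theta_{k-1}(1-\theta_{k-1})}{\sigma\theta_{k-1}^2+\theta_k}.$$ Then: 1. With $t_k=1/\theta_k$, the modified APG scheme coincides with FISTA-Mod with $p=\sigma$, $q=\sigma^2$, $r=4$, $\gamma=1/L$ and $t_0=1/\theta_0$ (so $t_0=1$ if $\theta_0=1$). 2. If $\theta_0=1$, then for every $x^\star\in\operatorname{Argmin}\Phi$ and every $k\ge1$, $$\Phi(x_k)-\Phi(x^\star)\le\frac{2L}{\sigma^2(k+1)^2}\,\|x_0-x^\star\|^2 .$$ 3. If $\sigma<1$, then, for every $\theta_0\in\,]0,1]$: $\Phi(x_k)<+\infty$ for all $k\ge1$ and $\Phi(x_k)-\min\Phi=o(1/k^2)$; the sequence $(x_k)$ converges weakly to a point of $\operatorname{Argmin}\Phi$; and $\|x_k-x_{k-1}\|=o(1/k)$. 4. If instead the momentum formula $a_k=\dfrac{\theta_{k-1}(1-\theta_{k-1})}{\theta_{k-1}^2+\theta_k}$ of the unmodified APG is kept (the same formula when $\sigma=1$), then all of 3. still holds, and 2. holds with $2L$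 replaced by $2L(2-\sigma)^2$. -/

import Mathlib

open Filter Topology Asymptotics

/-- `R : H → ]-∞, +∞]` is proper: it never takes the value `-∞` and is somewhere finite. -/
def ProperFun {H : Type*} (R : H → EReal) : Prop :=
  (∀ x, R x ≠ ⊥) ∧ ∃ x, R x ≠ ⊤

/-- Convexity of an extended-real-valued function, through convexity of its epigraph. -/
def ConvexFun {H : Type*} [AddCommGroup H] [Module ℝ H] (R : H → EReal) : Prop :=
  Convex ℝ {z : H × ℝ | R z.1 ≤ (z.2 : EReal)}

/-- The objective `Φ = F + R`. -/
noncomputable def objective {H : Type*} (F : H → ℝ) (R : H → EReal) (x : H) : EReal :=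
  (F x : EReal) + R x

/-- The set of global minimizers of an extended-real-valued function. -/
def minimizers {H : Type*} (Φ : H → EReal) : Set H :=
  {x | ∀ u, Φ x ≤ Φ u}

/-- `w = prox_{γ R}(z)`: the point `w` minimizes `u ↦ γ R(u) + ½ ‖u - z‖²`. -/
def IsProx {H : Type*} [NormedAddCommGroup H] (γ : ℝ) (R : H → EReal) (z w : H) : Prop :=
  w ∈ minimizers fun u => (γ : EReal) * R u + ((‖u - z‖ ^ 2 / 2 : ℝ) : EReal)

/-- The part shared by all the inertial forward-backward schemes: for the inertial parameters
`a k`, starting from an arbitrary `x 0` with the convention `x_{-1} = x_0` (whence `y_0 = x_0`),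
`y_k = x_k + a_k (x_k - x_{k-1})` and `x_{k+1} = prox_{γ R} (y_k - γ ∇F(y_k))`. -/
structure IsInertialFB {H : Type*} [NormedAddCommGroup H] [InnerProductSpace ℝ H]
    [CompleteSpace H] (F : H → ℝ) (R : H → EReal) (γ : ℝ) (a : ℕ → ℝ) (x y : ℕ → H) : Prop where
  y_zero : y 0 = x 0
  y_succ : ∀ k, y (k + 1) = x (k + 1) + a (k + 1) • (x (k + 1) - x k)
  x_succ : ∀ k, IsProx γ R (y k - γ • gradient F (y k)) (x (k + 1))

/-- FISTA-Mod with parameters `p, q, r`, step-size `γ` and initial value `t 0 = t₀`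
(the value `a 0` multiplies `x_0 - x_{-1} = 0` and plays no role). -/
structure IsFISTAMod {H : Type*} [NormedAddCommGroup H] [InnerProductSpace ℝ H]
    [CompleteSpace H] (F : H → ℝ) (R : H → EReal) (γ p q r t₀ : ℝ)
    (t a : ℕ → ℝ) (x y : ℕ → H) : Prop where
  t_zero : t 0 = t₀
  t_succ : ∀ k, t (k + 1) = (p + √(q + r * t k ^ 2)) / 2
  a_succ : ∀ k, a (k + 1) = (t k - 1) / t (k + 1)
  iter : IsInertialFB F R γ a x y

/-- The modified APG scheme with parameters `σ, τ`, initial value `θ 0 = θ₀` and step-size `1 / L`: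
`θ_k ≥ 0` solves `θ_k² = (1 - σ θ_k) θ_{k-1}² + τ θ_k`, and
`a_k = θ_{k-1} (1 - θ_{k-1}) / (κ θ_{k-1}² + θ_k)`.
The momentum weight is `κ = σ` for the scheme that extends FISTA-Mod, and `κ = 1` when the momentum
formula of the unmodified APG is kept unchanged; both are the APG formula when `σ = 1`. -/
structure IsMAPG {H : Type*} [NormedAddCommGroup H] [InnerProductSpace ℝ H]
    [CompleteSpace H] (F : H → ℝ) (R : H → EReal) (L σ τ κ θ₀ : ℝ)
    (θ a : ℕ → ℝ) (x y : ℕ → H) : Prop where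
  θ_zero : θ 0 = θ₀
  θ_nonneg : ∀ k, 0 ≤ θ k
  θ_succ : ∀ k, θ (k + 1) ^ 2 = (1 - σ * θ (k + 1)) * θ k ^ 2 + τ * θ (k + 1)
  a_succ : ∀ k, a (k + 1) = θ k * (1 - θ k) / (κ * θ k ^ 2 + θ (k + 1))
  iter : IsInertialFB F R (1 / L) a x y

/-!
With `t_k = 1 / θ_k` the recurrence `θ_{k+1}² = (1 - σ θ_{k+1}) θ_k²` reads
`t_{k+1}² - σ t_{k+1} = t_k²`, whose positive root is the FISTA-Mod update. For a momentum weight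
`κ ∈ [σ, 1]`, the inertial parameter is `(t_k - 1) / (t_{k+1} + κ - σ)`, so that the shifted and
rescaled sequence `T_k = (t_k + κ - σ) / (1 + κ - σ)` satisfies `a_{k+1} = (T_k - 1) / T_{k+1}`
and `T_{k+1}² - T_{k+1} + δ T_{k+1} ≤ T_k²` with `δ = (1 - σ) / (1 + κ - σ)²`
(`IsMAPG.exists_momentum`). Both momentum formulas are thus instances of one inertial
forward-backward scheme driven by `T`.

All estimates come from the inequality
`Φ(x⁺) + L/2 ‖u - x⁺‖² ≤ Φ(u) + L/2 ‖u - y‖²` for a forward-backward step `y ↦ x⁺` and any `u`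
in the domain (`forwardBackward_inequality`). Write `w_k = Φ(x_k) - min Φ`,
`d_k = L/2 ‖x_k - x_{k-1}‖²` and `u_k = T_{k-1} x_k - (T_{k-1} - 1) x_{k-1} - x⋆`.

* With `u = (1 - 1/T_k) x_k + (1/T_k) x⋆`, the inequality gives
  `T_k² w_{k+1} + L/2 ‖u_{k+1}‖² ≤ (T_k² - T_k) w_k + L/2 ‖u_k‖²` (`energy_step`). Hence
  `T_{k-1}² w_k + L/2 ‖u_k‖²` decreases, which is the `O(1/k²)` bound when `T_0 = 1`; and
  `∑ T_k w_k < ∞` when `δ > 0`.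
* With `u = x_k`, it gives `w_{k+1} + d_{k+1} ≤ w_k + a_k² d_k`. After multiplication by `T_k²`,
  the summability just obtained shows that `Z_k = T_{k-1}² (w_k + d_k)` converges and that
  `∑ Z_k / T_{k-1} < ∞`. As `T` grows at most linearly, `Z_k → 0`
  (`tendsto_zero_of_inertial_inequalities`): these are the two `o` rates.
* The decreasing energy then makes `‖u_k‖` converge, and `u_k - (x_k - x⋆)` has norm at most
  `T_{k-1} ‖x_k - x_{k-1}‖ → 0`. So `‖x_k - x⋆‖` converges for every minimizer `x⋆`, weak cluster
  points are minimizers because sublevel sets of `Φ` are closed and convex, and Opial's lemma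
  (`exists_weak_limit_of_opial`) yields weak convergence.
-/

/-! ### Real sequences -/

/-- A nonnegative sequence that is decreasing up to summable errors `c` converges, and its
decrements `b` are summable. -/
lemma exists_tendsto_and_summable_of_quasi_antitone {Z b c : ℕ → ℝ} (hZ : ∀ n, 0 ≤ Z n)
    (hb : ∀ n, 0 ≤ b n) (hc : ∀ n, 0 ≤ c n) (hcs : Summable c)
    (h : ∀ n, Z (n + 1) + b n ≤ Z n + c n) :
    (∃ l, Tendsto Z atTop (𝓝 l)) ∧ Summable b := by
  have hc_sum := hcs.hasSum.tendsto_sum_nat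
  constructor
  · have hanti : Antitone fun n => Z n - ∑ i ∈ Finset.range n, c i := by
      refine antitone_nat_of_succ_le fun n => ?_
      rw [Finset.sum_range_succ]
      linarith [h n, hb n]
    have hbdd : BddBelow (Set.range fun n => Z n - ∑ i ∈ Finset.range n, c i) := by
      refine ⟨-∑' i, c i, ?_⟩
      rintro _ ⟨n, rfl⟩
      have := hcs.sum_le_tsum (Finset.range n) fun i _ => hc i
      have := hZ n
      dsimp only
      linarith
    refine ⟨_, ((tendsto_atTop_ciInf hanti hbdd).add hc_sum).congr fun n => ?_⟩
    ring
  · refine summable_of_sum_range_le (c := Z 0 + ∑' i, c i) hb fun n => ?_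
    have key : Z n + ∑ i ∈ Finset.range n, b i ≤ Z 0 + ∑ i ∈ Finset.range n, c i := by
      induction n with
      | zero => simp
      | succ n ih =>
        rw [Finset.sum_range_succ, Finset.sum_range_succ]
        linarith [h n]
    have := hcs.sum_le_tsum (Finset.range n) fun i _ => hc i
    linarith [hZ n]

/-- Since `∑ 1 / T n` diverges for `T` of at most linear growth, the limit of `Z` cannot be
positive. -/
lemma tendsto_zero_of_summable_div {Z T : ℕ → ℝ} {l C : ℝ} (hZ : ∀ n, 0 ≤ Z n)
    (hT : ∀ n, 0 < T n) (hTC : ∀ n, T n ≤ C * (n + 1)) (hl : Tendsto Z atTop (𝓝 l))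
    (hs : Summable fun n => Z n / T n) : Tendsto Z atTop (𝓝 0) := by
  have hl0 : 0 ≤ l := ge_of_tendsto' hl hZ
  rcases hl0.eq_or_lt with rfl | hlpos
  · exact hl
  exfalso
  have hC : 0 < C := by simpa using (hT 0).trans_le (hTC 0)
  obtain ⟨N, hN⟩ := eventually_atTop.1 (hl.eventually (lt_mem_nhds (half_lt_self hlpos)))
  refine Real.not_summable_one_div_natCast ?_
  refine (summable_nat_add_iff (N + 1)).1 ?_
  refine Summable.of_nonneg_of_le (fun n => by positivity) (fun n => ?_)
    (((summable_nat_add_iff N).2 hs).mul_left (2 * C / l))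
  have h1 := hN (n + N) (Nat.le_add_left _ _)
  have h2 := hTC (n + N)
  have h3 := hT (n + N)
  push_cast at h2 ⊢
  calc 1 / ((n : ℝ) + (N + 1)) ≤ C / T (n + N) := by
        rw [div_le_div_iff₀ (by positivity) h3]; linarith
    _ = 2 * C / l * (l / 2 / T (n + N)) := by field_simp
    _ ≤ 2 * C / l * (Z (n + N) / T (n + N)) := by gcongr

/-- The scalar part of the convergence proof: `W` stands for the objective gap, `D` for the squared
step and `V` for the squared distance term of the energy. -/
theorem tendsto_zero_of_inertial_inequalities {T W D V : ℕ → ℝ} {δ C : ℝ} (hδ : 0 < δ)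
    (hT : ∀ n, 1 ≤ T n) (hT_mono : Monotone T) (hTC : ∀ n, T n ≤ C * (n + 1))
    (hTδ : ∀ n, T (n + 1) ^ 2 - T (n + 1) + δ * T (n + 1) ≤ T n ^ 2)
    (hW : ∀ n, 0 ≤ W n) (hD : ∀ n, 0 ≤ D n) (hV : ∀ n, 0 ≤ V n)
    (hE : ∀ n, T (n + 1) ^ 2 * W (n + 1) + V (n + 1) ≤
      (T (n + 1) ^ 2 - T (n + 1)) * W n + V n)
    (hWD : ∀ n, W (n + 1) + D (n + 1) ≤ W n + ((T n - 1) / T (n + 1)) ^ 2 * D n) :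
    Tendsto (fun n => T n ^ 2 * W n) atTop (𝓝 0) ∧
      Tendsto (fun n => T n ^ 2 * D n) atTop (𝓝 0) ∧ ∃ l, Tendsto V atTop (𝓝 l) := by
  have hTpos : ∀ n, 0 < T n := fun n => one_pos.trans_le (hT n)
  obtain ⟨⟨l, hl⟩, hsW⟩ := exists_tendsto_and_summable_of_quasi_antitone
    (Z := fun n => T n ^ 2 * W n + V n) (b := fun n => δ * (T (n + 1) * W n)) (c := fun _ => 0)
    (fun n => add_nonneg (mul_nonneg (sq_nonneg _) (hW n)) (hV n))
    (fun n => mul_nonneg hδ.le (mul_nonneg (hTpos _).le (hW n))) (fun _ => le_rfl)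
    summable_zero (fun n => by
      have := mul_le_mul_of_nonneg_right (hTδ n) (hW n)
      linarith [hE n])
  have hsW' : Summable fun n => T (n + 1) * W n := (summable_mul_left_iff hδ.ne').1 hsW
  -- The decrement `T n * D n` is available because `(T n - 1) ^ 2 ≤ T n ^ 2 - T n` for `1 ≤ T n`.
  obtain ⟨⟨m, hm⟩, hsD⟩ := exists_tendsto_and_summable_of_quasi_antitone
    (Z := fun n => T n ^ 2 * (W n + D n)) (b := fun n => T n * D n)
    (c := fun n => T (n + 1) * W n)
    (fun n => mul_nonneg (sq_nonneg _) (add_nonneg (hW n) (hD n)))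
    (fun n => mul_nonneg (hTpos _).le (hD n)) (fun n => mul_nonneg (hTpos _).le (hW n))
    hsW' (fun n => by
      have h1 := mul_le_mul_of_nonneg_left (hWD n) (sq_nonneg (T (n + 1)))
      have h2 : T (n + 1) ^ 2 * (W n + ((T n - 1) / T (n + 1)) ^ 2 * D n) =
          T (n + 1) ^ 2 * W n + (T n - 1) ^ 2 * D n := by
        have := (hTpos (n + 1)).ne'
        field_simp
      have h3 : (T (n + 1) ^ 2 - T (n + 1)) * W n ≤ T n ^ 2 * W n :=
        mul_le_mul_of_nonneg_right
          (by linarith [hTδ n, mul_nonneg hδ.le (hTpos (n + 1)).le]) (hW n)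
      have h4 : (T n - 1) ^ 2 * D n ≤ (T n ^ 2 - T n) * D n :=
        mul_le_mul_of_nonneg_right (by nlinarith [hT n]) (hD n)
      linarith)
  have hs : Summable fun n => T n ^ 2 * (W n + D n) / T n := by
    refine Summable.of_nonneg_of_le
      (fun n => div_nonneg (mul_nonneg (sq_nonneg _) (add_nonneg (hW n) (hD n))) (hTpos n).le)
      (fun n => ?_) (hsW'.add hsD)
    have h1 : T n ^ 2 * (W n + D n) / T n = T n * W n + T n * D n := by
      have := (hTpos n).ne'
      field_simp
    rw [h1]
    gcongr
    · exact hW n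
    · exact hT_mono n.le_succ
  have hZ := tendsto_zero_of_summable_div
    (fun n => mul_nonneg (sq_nonneg (T n)) (add_nonneg (hW n) (hD n))) hTpos hTC hm hs
  have hZW : Tendsto (fun n => T n ^ 2 * W n) atTop (𝓝 0) :=
    squeeze_zero (fun n => mul_nonneg (sq_nonneg _) (hW n))
      (fun n => mul_le_mul_of_nonneg_left (le_add_of_nonneg_right (hD n)) (sq_nonneg _)) hZ
  refine ⟨hZW, squeeze_zero (fun n => mul_nonneg (sq_nonneg _) (hD n))
      (fun n => mul_le_mul_of_nonneg_left (le_add_of_nonneg_left (hW n)) (sq_nonneg _)) hZ,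
    l - 0, (hl.sub hZW).congr fun n => by ring⟩

/-! ### Weak convergence in Hilbert spaces -/

section Hilbert

variable {H : Type*} [NormedAddCommGroup H] [InnerProductSpace ℝ H] [CompleteSpace H]

/-- A bounded family has a weak limit along every ultrafilter: the limits of the inner products
define a bounded linear functional, which the Riesz theorem represents. -/
lemma exists_tendsto_inner_of_bounded {ι : Type*} (U : Ultrafilter ι) {x : ι → H} {M : ℝ}
    (hM : ∀ n, ‖x n‖ ≤ M) :
    ∃ z : H, ∀ v, Tendsto (fun n => inner ℝ (x n) v) U (𝓝 (inner ℝ z v)) := by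
  have hb : ∀ v n, ‖inner ℝ (x n) v‖ ≤ M * ‖v‖ := fun v n =>
    (norm_inner_le_norm _ _).trans (mul_le_mul_of_nonneg_right (hM n) (norm_nonneg v))
  have hex : ∀ v, ∃ r : ℝ, Tendsto (fun n => inner ℝ (x n) v) U (𝓝 r) := by
    intro v
    obtain ⟨r, -, hr⟩ := (isCompact_closedBall (0 : ℝ) (M * ‖v‖)).ultrafilter_le_nhds
      (U.map fun n => inner ℝ (x n) v) (le_principal_iff.2 <| by
        refine mem_map.2 (univ_mem' fun n => ?_)
        simpa using hb v n)
    exact ⟨r, hr⟩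
  choose r hr using hex
  let f : H →ₗ[ℝ] ℝ :=
    { toFun := r
      map_add' := fun u v => tendsto_nhds_unique (hr (u + v))
        (((hr u).add (hr v)).congr fun n => (inner_add_right _ _ _).symm)
      map_smul' := fun c v => tendsto_nhds_unique (hr (c • v))
        (((hr v).const_mul c).congr fun n => (real_inner_smul_right _ _ _).symm) }
  let g : H →L[ℝ] ℝ := f.mkContinuous M fun v =>
    le_of_tendsto (hr v).norm (Eventually.of_forall (hb v))
  refine ⟨(InnerProductSpace.toDual ℝ H).symm g, fun v => ?_⟩
  rw [InnerProductSpace.toDual_symm_apply]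
  exact hr v

/-- A closed convex set is closed under weak limits. -/
lemma mem_of_tendsto_inner {ι : Type*} {l : Filter ι} [l.NeBot] {C : Set H} (hC : Convex ℝ C)
    (hC' : IsClosed C) {x : ι → H} {z : H} (hx : ∀ᶠ n in l, x n ∈ C)
    (hz : ∀ v, Tendsto (fun n => inner ℝ (x n) v) l (𝓝 (inner ℝ z v))) : z ∈ C := by
  by_contra hzC
  obtain ⟨f, s, hfz, hfs⟩ := geometric_hahn_banach_point_closed hC hC' hzC
  have hf : ∀ u, f u = inner ℝ u ((InnerProductSpace.toDual ℝ H).symm f) := fun u => by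
    rw [real_inner_comm, InnerProductSpace.toDual_symm_apply]
  refine absurd (ge_of_tendsto (hz _) (hx.mono fun n hn => ?_))
    (not_le.2 ((hf z).symm.trans_lt hfz))
  exact (hf _) ▸ (hfs _ hn).le

/-- **Opial's lemma.** The distances to two weak cluster points `z` and `z'` converge, hence so does
`⟪x n, z - z'⟫`, which forces `z = z'`; a bounded sequence whose weak limits along all ultrafilters
agree converges weakly. -/
theorem exists_weak_limit_of_opial {x : ℕ → H} {S : Set H} (hS : S.Nonempty)
    (hlim : ∀ s ∈ S, ∃ l, Tendsto (fun n => ‖x n - s‖) atTop (𝓝 l))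
    (hclus : ∀ (U : Ultrafilter ℕ) (z : H), ↑U ≤ (atTop : Filter ℕ) →
      (∀ v, Tendsto (fun n => inner ℝ (x n) v) U (𝓝 (inner ℝ z v))) → z ∈ S) :
    ∃ z ∈ S, Tendsto (fun n => toWeakSpace ℝ H (x n)) atTop (𝓝 (toWeakSpace ℝ H z)) := by
  obtain ⟨s, hs⟩ := hS
  obtain ⟨l, hl⟩ := hlim s hs
  obtain ⟨M, hM⟩ := hl.bddAbove_range
  have hbd : ∀ n, ‖x n‖ ≤ M + ‖s‖ := fun n => by
    have h1 : ‖x n - s‖ ≤ M := hM ⟨n, rfl⟩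
    have h2 := norm_add_le (x n - s) s
    rw [sub_add_cancel] at h2
    linarith
  have huniq : ∀ (U V : Ultrafilter ℕ) (z z' : H), ↑U ≤ (atTop : Filter ℕ) →
      ↑V ≤ (atTop : Filter ℕ) →
      (∀ v, Tendsto (fun n => inner ℝ (x n) v) U (𝓝 (inner ℝ z v))) →
      (∀ v, Tendsto (fun n => inner ℝ (x n) v) V (𝓝 (inner ℝ z' v))) → z = z' := by
    intro U V z z' hU hV hz hz'
    obtain ⟨a, ha⟩ := hlim z (hclus U z hU hz)
    obtain ⟨b, hb⟩ := hlim z' (hclus V z' hV hz')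
    have hin : Tendsto (fun n => inner ℝ (x n) (z - z')) atTop
        (𝓝 ((b ^ 2 - a ^ 2 + (‖z‖ ^ 2 - ‖z'‖ ^ 2)) / 2)) := by
      refine ((((hb.pow 2).sub (ha.pow 2)).add_const _).div_const 2).congr fun n => ?_
      rw [norm_sub_sq_real, norm_sub_sq_real, inner_sub_right]
      ring
    have h1 := tendsto_nhds_unique (hz (z - z')) (hin.mono_left hU)
    have h2 := tendsto_nhds_unique (hz' (z - z')) (hin.mono_left hV)
    rw [← sub_eq_zero, ← inner_self_eq_zero (𝕜 := ℝ), inner_sub_left, h1, h2, sub_self]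
  obtain ⟨z, hz⟩ := exists_tendsto_inner_of_bounded (hyperfilter ℕ) hbd
  have hU₀ : ((hyperfilter ℕ : Ultrafilter ℕ) : Filter ℕ) ≤ atTop := by
    rw [← Nat.cofinite_eq_atTop]; exact hyperfilter_le_cofinite
  refine ⟨z, hclus _ z hU₀ hz, ?_⟩
  have hinner : ∀ v, Tendsto (fun n => inner ℝ (x n) v) atTop (𝓝 (inner ℝ z v)) := by
    intro v
    refine tendsto_iff_ultrafilter _ _ _ |>.2 fun U hU => ?_
    obtain ⟨z', hz'⟩ := exists_tendsto_inner_of_bounded U hbd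
    rw [huniq _ U z z' hU₀ hU hz hz']
    exact hz' v
  have hind : IsInducing fun (w : WeakSpace ℝ H) (f : H →L[ℝ] ℝ) =>
    (topDualPairing ℝ H).flip w f := ⟨rfl⟩
  refine hind.tendsto_nhds_iff.2 (tendsto_pi_nhds.2 fun f => ?_)
  have hf : ∀ u : H, f u = inner ℝ u ((InnerProductSpace.toDual ℝ H).symm f) := fun u => by
    rw [real_inner_comm, InnerProductSpace.toDual_symm_apply]
  have h := hinner ((InnerProductSpace.toDual ℝ H).symm f)
  simp only [← hf] at h
  exact h

end Hilbert

/-! ### The extended-real-valued objective -/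

section ExtendedReal

variable {H : Type*}

lemma ProperFun.coe_toReal {R : H → EReal} (hR : ProperFun R) {x : H} (hx : R x ≠ ⊤) :
    ((R x).toReal : EReal) = R x :=
  EReal.coe_toReal hx (hR.1 x)

lemma coe_mul_add_coe_eq {γ c : ℝ} {R : H → EReal} (hR : ProperFun R) {u : H} (hu : R u ≠ ⊤) :
    (γ : EReal) * R u + (c : EReal) = ((γ * (R u).toReal + c : ℝ) : EReal) := by
  rw [EReal.coe_add, EReal.coe_mul, hR.coe_toReal hu]

lemma ConvexFun.le_combo [AddCommGroup H] [Module ℝ H] {R : H → EReal} (hR : ConvexFun R)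
    (hRp : ProperFun R) {u v : H} (hu : R u ≠ ⊤) (hv : R v ≠ ⊤) {s t : ℝ} (hs : 0 ≤ s)
    (ht : 0 ≤ t) (hst : s + t = 1) :
    R (s • u + t • v) ≤ ((s * (R u).toReal + t * (R v).toReal : ℝ) : EReal) :=
  hR (x := (u, (R u).toReal)) (hRp.coe_toReal hu).ge (y := (v, (R v).toReal))
    (hRp.coe_toReal hv).ge hs ht hst

/-- The real value of `Φ = F + R`, meaningful where `R` is finite. -/
noncomputable def realObjective (F : H → ℝ) (R : H → EReal) (x : H) : ℝ :=
  F x + (R x).toReal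

lemma objective_eq_coe {F : H → ℝ} {R : H → EReal} (hR : ProperFun R) {x : H} (hx : R x ≠ ⊤) :
    objective F R x = (realObjective F R x : EReal) := by
  rw [objective, realObjective, EReal.coe_add, hR.coe_toReal hx]

lemma realObjective_combo_le [AddCommGroup H] [Module ℝ H] {F : H → ℝ} {R : H → EReal}
    (hF : ConvexOn ℝ Set.univ F) (hR : ConvexFun R) (hRp : ProperFun R) {u v : H} (hu : R u ≠ ⊤)
    (hv : R v ≠ ⊤) {s t : ℝ} (hs : 0 ≤ s) (ht : 0 ≤ t) (hst : s + t = 1) :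
    R (s • u + t • v) ≠ ⊤ ∧ realObjective F R (s • u + t • v) ≤
      s * realObjective F R u + t * realObjective F R v := by
  have h1 := hR.le_combo hRp hu hv hs ht hst
  have hne : R (s • u + t • v) ≠ ⊤ := ne_top_of_le_ne_top (EReal.coe_ne_top _) h1
  refine ⟨hne, ?_⟩
  rw [← hRp.coe_toReal hne, EReal.coe_le_coe_iff] at h1
  have h2 := hF.2 (Set.mem_univ u) (Set.mem_univ v) hs ht hst
  simp only [smul_eq_mul] at h2
  unfold realObjective
  linarith

lemma ne_top_of_mem_minimizers {F : H → ℝ} {R : H → EReal} (hR : ProperFun R) {xs : H}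
    (hxs : xs ∈ minimizers (objective F R)) : R xs ≠ ⊤ := by
  obtain ⟨u, hu⟩ := hR.2
  intro h
  have h1 := hxs u
  rw [objective_eq_coe hR hu, objective, h, EReal.coe_add_top, top_le_iff] at h1
  exact EReal.coe_ne_top _ h1

lemma realObjective_le_of_mem_minimizers {F : H → ℝ} {R : H → EReal} (hR : ProperFun R)
    {xs u : H} (hxs : xs ∈ minimizers (objective F R)) (hu : R u ≠ ⊤) :
    realObjective F R xs ≤ realObjective F R u := by
  have h1 := hxs u
  rwa [objective_eq_coe hR hu, objective_eq_coe hR (ne_top_of_mem_minimizers hR hxs),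
    EReal.coe_le_coe_iff] at h1

lemma objective_le_coe_iff {F : H → ℝ} {R : H → EReal} {c : ℝ} {x : H} :
    objective F R x ≤ c ↔ R x ≤ ((c - F x : ℝ) : EReal) := by
  rw [objective, EReal.coe_sub, add_comm, EReal.le_sub_iff_add_le] <;> simp

lemma isClosed_sublevel [TopologicalSpace H] {F : H → ℝ} {R : H → EReal} (hF : Continuous F)
    (hR : LowerSemicontinuous R) (c : ℝ) : IsClosed {x | objective F R x ≤ c} := by
  simp only [objective_le_coe_iff]
  have hcont : Continuous fun x => (x, ((c - F x : ℝ) : EReal)) :=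
    continuous_id.prodMk (continuous_coe_real_ereal.comp (continuous_const.sub hF))
  exact hR.isClosed_epigraph.preimage hcont

lemma convex_sublevel [AddCommGroup H] [Module ℝ H] {F : H → ℝ} {R : H → EReal}
    (hF : ConvexOn ℝ Set.univ F) (hR : ConvexFun R) (hRp : ProperFun R) (c : ℝ) :
    Convex ℝ {x | objective F R x ≤ c} := by
  have hdom : ∀ u, objective F R u ≤ c → R u ≠ ⊤ := fun u hu =>
    ne_top_of_le_ne_top (EReal.coe_ne_top _) (objective_le_coe_iff.1 hu)
  intro u hu v hv s t hs ht hst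
  obtain ⟨h1, h2⟩ := realObjective_combo_le hF hR hRp (hdom u hu) (hdom v hv) hs ht hst
  simp only [Set.mem_ofPred_eq] at hu hv ⊢
  rw [objective_eq_coe hRp (hdom u hu), EReal.coe_le_coe_iff] at hu
  rw [objective_eq_coe hRp (hdom v hv), EReal.coe_le_coe_iff] at hv
  rw [objective_eq_coe hRp h1, EReal.coe_le_coe_iff]
  calc _ ≤ _ := h2
    _ ≤ s * c + t * c := by gcongr
    _ = c := by rw [← add_mul, hst, one_mul]

end ExtendedReal

/-! ### The proximal step and the forward-backward inequality -/

section Hilbert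

variable {H : Type*} [NormedAddCommGroup H]

lemma IsProx.ne_top {γ : ℝ} (hγ : 0 < γ) {R : H → EReal} (hR : ProperFun R) {z w : H}
    (hw : IsProx γ R z w) : R w ≠ ⊤ := by
  obtain ⟨u, hu⟩ := hR.2
  intro h
  have h1 := hw u
  dsimp only at h1
  rw [coe_mul_add_coe_eq hR hu, h, EReal.coe_mul_top_of_pos hγ, EReal.top_add_coe,
    top_le_iff] at h1
  exact EReal.coe_ne_top _ h1

variable [InnerProductSpace ℝ H]

lemma norm_combo_sub_sq (u w z : H) (s : ℝ) :
    ‖(1 - s) • w + s • u - z‖ ^ 2 =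
      (1 - s) * ‖w - z‖ ^ 2 + s * ‖u - z‖ ^ 2 - s * (1 - s) * ‖u - w‖ ^ 2 := by
  have h1 : (1 - s) • w + s • u - z = (1 - s) • (w - z) + s • (u - z) := by module
  have h2 : u - w = (u - z) - (w - z) := by abel
  rw [h1, h2, norm_add_sq_real, norm_sub_sq_real (u - z), norm_smul, norm_smul,
    real_inner_smul_left, real_inner_smul_right, mul_pow, mul_pow, Real.norm_eq_abs,
    Real.norm_eq_abs, sq_abs, sq_abs, real_inner_comm (u - z)]
  ring

/-- The proximal objective is `1`-strongly convex, so it grows at least quadratically around its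
minimizer. -/
lemma IsProx.add_norm_sub_sq_le {γ : ℝ} (hγ : 0 < γ) {R : H → EReal} (hRp : ProperFun R)
    (hR : ConvexFun R) {z w u : H} (hw : IsProx γ R z w) (hu : R u ≠ ⊤) :
    γ * (R w).toReal + ‖w - z‖ ^ 2 / 2 + ‖u - w‖ ^ 2 / 2 ≤
      γ * (R u).toReal + ‖u - z‖ ^ 2 / 2 := by
  have hwt := hw.ne_top hγ hRp
  -- Compare `w` with the point `(1 - s) w + s u` and divide by `s`; the claim is the limit `s → 0`.
  have key : ∀ s ∈ Set.Ioo (0 : ℝ) 1, γ * (R w).toReal + ‖w - z‖ ^ 2 / 2 + ‖u - w‖ ^ 2 / 2 ≤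
      γ * (R u).toReal + ‖u - z‖ ^ 2 / 2 + s * (‖u - w‖ ^ 2 / 2) := by
    intro s hs
    have h1 := hR.le_combo hRp hwt hu (sub_nonneg.2 hs.2.le) hs.1.le (sub_add_cancel 1 s)
    have hne := ne_top_of_le_ne_top (EReal.coe_ne_top _) h1
    rw [← hRp.coe_toReal hne, EReal.coe_le_coe_iff] at h1
    have h2 := hw ((1 - s) • w + s • u)
    dsimp only at h2
    rw [coe_mul_add_coe_eq hRp hne, coe_mul_add_coe_eq hRp hwt, EReal.coe_le_coe_iff,
      norm_combo_sub_sq] at h2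
    have h3 := mul_le_mul_of_nonneg_left h1 hγ.le
    refine le_of_mul_le_mul_left ?_ hs.1
    linarith
  have hlim : Tendsto (fun s : ℝ => γ * (R u).toReal + ‖u - z‖ ^ 2 / 2 + s * (‖u - w‖ ^ 2 / 2))
      (𝓝[>] 0) (𝓝 (γ * (R u).toReal + ‖u - z‖ ^ 2 / 2 + 0 * (‖u - w‖ ^ 2 / 2))) :=
    (Continuous.tendsto (by fun_prop) _).mono_left nhdsWithin_le_nhds
  rw [zero_mul, add_zero] at hlim
  exact ge_of_tendsto hlim (eventually_of_mem (Ioo_mem_nhdsGT one_pos) key)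

variable [CompleteSpace H]

lemma hasDerivAt_comp_line {F : H → ℝ} (hF : Differentiable ℝ F) (y d : H) (s : ℝ) :
    HasDerivAt (fun s : ℝ => F (y + s • d)) (inner ℝ (gradient F (y + s • d)) d) s := by
  have h1 : HasDerivAt (fun s : ℝ => y + s • d) d s := by
    simpa using ((hasDerivAt_id s).smul_const d).const_add y
  rw [inner_gradient_left]
  exact (hF _).hasFDerivAt.comp_hasDerivAt s h1

/-- The graph of a convex function lies above its tangents. -/
lemma ConvexOn.add_inner_gradient_le {F : H → ℝ} (hc : ConvexOn ℝ Set.univ F)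
    (hF : Differentiable ℝ F) (y u : H) : F y + inner ℝ (gradient F y) (u - y) ≤ F u := by
  have hc' : ConvexOn ℝ Set.univ fun s : ℝ => F (y + s • (u - y)) := by
    refine ⟨convex_univ, fun a _ b _ s t hs ht hst => ?_⟩
    have h := hc.2 (Set.mem_univ (y + a • (u - y))) (Set.mem_univ (y + b • (u - y))) hs ht hst
    convert h using 2
    obtain rfl : t = 1 - s := by linarith
    simp only [smul_eq_mul]
    module
  have h := hc'.le_slope_of_hasDerivAt (Set.mem_univ 0) (Set.mem_univ 1) one_pos
    (hasDerivAt_comp_line hF y (u - y) 0)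
  simp only [slope_def_field, zero_smul, one_smul, add_zero, add_sub_cancel, sub_zero,
    div_one] at h
  linarith

/-- The descent lemma for functions with Lipschitz gradient. -/
lemma le_add_inner_gradient_add_sq {F : H → ℝ} {L : ℝ} (hF : Differentiable ℝ F)
    (hL : ∀ u v, ‖gradient F u - gradient F v‖ ≤ L * ‖u - v‖) (y w : H) :
    F w ≤ F y + inner ℝ (gradient F y) (w - y) + L / 2 * ‖w - y‖ ^ 2 := by
  set d := w - y with hd
  have hder : ∀ s : ℝ, HasDerivAt
      (fun s : ℝ => F (y + s • d) - s * inner ℝ (gradient F y) d - L / 2 * ‖d‖ ^ 2 * s ^ 2)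
      (inner ℝ (gradient F (y + s • d)) d - inner ℝ (gradient F y) d - L * ‖d‖ ^ 2 * s) s := by
    intro s
    refine (((hasDerivAt_comp_line hF y d s).sub ((hasDerivAt_id s).mul_const _)).sub
      ((hasDerivAt_pow 2 s).const_mul (L / 2 * ‖d‖ ^ 2))).congr_deriv ?_
    simp only [one_mul, Nat.cast_ofNat, Nat.add_one_sub_one, pow_one]
    ring
  have hanti : AntitoneOn
      (fun s : ℝ => F (y + s • d) - s * inner ℝ (gradient F y) d - L / 2 * ‖d‖ ^ 2 * s ^ 2)
      (Set.Icc 0 1) := by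
    refine antitoneOn_of_deriv_nonpos (convex_Icc 0 1)
      (fun s _ => (hder s).continuousAt.continuousWithinAt)
      (fun s _ => (hder s).differentiableAt.differentiableWithinAt) fun s hs => ?_
    rw [interior_Icc] at hs
    rw [(hder s).deriv, ← inner_sub_left]
    have h1 := real_inner_le_norm (gradient F (y + s • d) - gradient F y) d
    have h2 := hL (y + s • d) y
    rw [add_sub_cancel_left, norm_smul, Real.norm_of_nonneg hs.1.le] at h2
    have h3 := mul_le_mul_of_nonneg_right h2 (norm_nonneg d)
    linarith
  have h := hanti (Set.left_mem_Icc.2 zero_le_one) (Set.right_mem_Icc.2 zero_le_one) zero_le_one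
  simp only [one_smul, zero_smul, add_zero, hd, add_sub_cancel] at h
  rw [← hd] at h
  linarith

/-- The basic inequality of a forward-backward step of size `1 / L` from `y` to `w`, against an
arbitrary comparison point `u` of the domain. -/
theorem forwardBackward_inequality {F : H → ℝ} {R : H → EReal} {L : ℝ} (hL : 0 < L)
    (hRp : ProperFun R) (hRc : ConvexFun R) (hFc : ConvexOn ℝ Set.univ F)
    (hF : Differentiable ℝ F) (hlip : ∀ u v, ‖gradient F u - gradient F v‖ ≤ L * ‖u - v‖)
    {y w u : H} (hw : IsProx (1 / L) R (y - (1 / L) • gradient F y) w) (hu : R u ≠ ⊤) :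
    realObjective F R w + L / 2 * ‖u - w‖ ^ 2 ≤ realObjective F R u + L / 2 * ‖u - y‖ ^ 2 := by
  have h1 := hw.add_norm_sub_sq_le (one_div_pos.2 hL) hRp hRc hu
  have hexp : ∀ v : H, ‖v - (y - (1 / L) • gradient F y)‖ ^ 2 =
      ‖v - y‖ ^ 2 + 2 / L * inner ℝ (gradient F y) (v - y) + ‖(1 / L) • gradient F y‖ ^ 2 := by
    intro v
    rw [sub_sub_eq_add_sub, add_sub_right_comm, norm_add_sq_real, real_inner_smul_right,
      real_inner_comm]
    ring
  rw [hexp, hexp] at h1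
  have h2 := mul_le_mul_of_nonneg_left h1 hL.le
  have h3 : L * (1 / L * (R w).toReal + (‖w - y‖ ^ 2 + 2 / L * inner ℝ (gradient F y) (w - y) +
      ‖(1 / L) • gradient F y‖ ^ 2) / 2 + ‖u - w‖ ^ 2 / 2) = (R w).toReal +
      L / 2 * ‖w - y‖ ^ 2 + inner ℝ (gradient F y) (w - y) +
      L / 2 * ‖(1 / L) • gradient F y‖ ^ 2 + L / 2 * ‖u - w‖ ^ 2 := by field_simp; ring
  have h4 : L * (1 / L * (R u).toReal + (‖u - y‖ ^ 2 + 2 / L * inner ℝ (gradient F y) (u - y) +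
      ‖(1 / L) • gradient F y‖ ^ 2) / 2) = (R u).toReal +
      L / 2 * ‖u - y‖ ^ 2 + inner ℝ (gradient F y) (u - y) +
      L / 2 * ‖(1 / L) • gradient F y‖ ^ 2 := by field_simp; ring
  rw [h3, h4] at h2
  have h5 := le_add_inner_gradient_add_sq hF hlip y w
  have h6 := hFc.add_inner_gradient_le hF y u
  unfold realObjective
  linarith

end Hilbert

/-! ### Inertial forward-backward iterations -/

section Hilbert

variable {H : Type*} [NormedAddCommGroup H] [InnerProductSpace ℝ H]

/-- The forward-backward inequality at the comparison point `(1 - 1 / T) p + (1 / T) xs`, multiplied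
by `T²`. -/
lemma energy_step {F : H → ℝ} {R : H → EReal} {L T : ℝ} (hRp : ProperFun R) (hRc : ConvexFun R)
    (hFc : ConvexOn ℝ Set.univ F) (hT : 1 ≤ T) {y w p xs : H}
    (hw : ∀ u, R u ≠ ⊤ →
      realObjective F R w + L / 2 * ‖u - w‖ ^ 2 ≤ realObjective F R u + L / 2 * ‖u - y‖ ^ 2)
    (hp : R p ≠ ⊤) (hxs : R xs ≠ ⊤) :
    T ^ 2 * (realObjective F R w - realObjective F R xs) +
        L / 2 * ‖T • w - (T - 1) • p - xs‖ ^ 2 ≤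
      (T ^ 2 - T) * (realObjective F R p - realObjective F R xs) +
        L / 2 * ‖T • y - (T - 1) • p - xs‖ ^ 2 := by
  have hTpos : 0 < T := one_pos.trans_le hT
  have hs : 0 ≤ 1 - 1 / T := sub_nonneg.2 ((div_le_one hTpos).2 hT)
  obtain ⟨h1, h2⟩ := realObjective_combo_le hFc hRc hRp hp hxs hs (one_div_pos.2 hTpos).le
    (sub_add_cancel _ _)
  have h3 := mul_le_mul_of_nonneg_left ((hw _ h1).trans (add_le_add_left h2 _)) (sq_nonneg T)
  have h4 : ∀ v : H, ‖T • v - (T - 1) • p - xs‖ ^ 2 =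
      T ^ 2 * ‖(1 - 1 / T) • p + (1 / T) • xs - v‖ ^ 2 := by
    intro v
    rw [← sq_abs T, ← Real.norm_eq_abs, ← mul_pow, ← norm_smul, ← norm_neg]
    congr 2
    rw [smul_sub, smul_add, smul_smul, smul_smul, mul_sub, mul_one_div_cancel hTpos.ne']
    module
  rw [h4, h4]
  have h5 : T ^ 2 * ((1 - 1 / T) * realObjective F R p + 1 / T * realObjective F R xs) =
      (T ^ 2 - T) * realObjective F R p + T * realObjective F R xs := by
    field_simp
  linarith

namespace IsInertialFB

variable [CompleteSpace H] {F : H → ℝ} {R : H → EReal} {L : ℝ} {a T : ℕ → ℝ} {x y : ℕ → H} {xs : H}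

/-- The momentum `a (n + 1) = (T n - 1) / T (n + 1)` is exactly what turns the distance term of
`energy_step` at `y (n + 1)` into the one left over from the previous step. The recursion starts
at `x 1`, since `R (x 0)` may be infinite. -/
lemma energy_succ_le (hx : IsInertialFB F R (1 / L) a x y) (hL : 0 < L)
    (hRp : ProperFun R) (hRc : ConvexFun R) (hFc : ConvexOn ℝ Set.univ F)
    (hF : Differentiable ℝ F) (hlip : ∀ u v, ‖gradient F u - gradient F v‖ ≤ L * ‖u - v‖)
    (hT : ∀ n, 1 ≤ T n) (ha : ∀ n, a (n + 1) = (T n - 1) / T (n + 1)) (hxs : R xs ≠ ⊤) (n : ℕ) :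
    T (n + 1) ^ 2 * (realObjective F R (x (n + 2)) - realObjective F R xs) +
        L / 2 * ‖T (n + 1) • x (n + 2) - (T (n + 1) - 1) • x (n + 1) - xs‖ ^ 2 ≤
      (T (n + 1) ^ 2 - T (n + 1)) * (realObjective F R (x (n + 1)) - realObjective F R xs) +
        L / 2 * ‖T n • x (n + 1) - (T n - 1) • x n - xs‖ ^ 2 := by
  have h := energy_step hRp hRc hFc (hT (n + 1))
    (fun u hu => forwardBackward_inequality hL hRp hRc hFc hF hlip (hx.x_succ (n + 1)) hu)
    ((hx.x_succ n).ne_top (one_div_pos.2 hL) hRp) hxs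
  have hy : T (n + 1) • y (n + 1) - (T (n + 1) - 1) • x (n + 1) - xs =
      T n • x (n + 1) - (T n - 1) • x n - xs := by
    rw [hx.y_succ, ha, smul_add, smul_smul,
      mul_div_cancel₀ _ (one_pos.trans_le (hT (n + 1))).ne']
    module
  rwa [hy] at h

/-- With `T 0 = 1` the first energy does not involve the possibly infinite value at `x 0`. -/
theorem sq_mul_gap_le (hx : IsInertialFB F R (1 / L) a x y) (hL : 0 < L)
    (hRp : ProperFun R) (hRc : ConvexFun R) (hFc : ConvexOn ℝ Set.univ F)
    (hF : Differentiable ℝ F) (hlip : ∀ u v, ‖gradient F u - gradient F v‖ ≤ L * ‖u - v‖)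
    (hT : ∀ n, 1 ≤ T n) (hT0 : T 0 = 1) (hTT : ∀ n, T (n + 1) ^ 2 - T (n + 1) ≤ T n ^ 2)
    (ha : ∀ n, a (n + 1) = (T n - 1) / T (n + 1)) (hxs : xs ∈ minimizers (objective F R))
    (n : ℕ) :
    T n ^ 2 * (realObjective F R (x (n + 1)) - realObjective F R xs) ≤
      L / 2 * ‖x 0 - xs‖ ^ 2 := by
  have hxs' := ne_top_of_mem_minimizers hRp hxs
  suffices h : T n ^ 2 * (realObjective F R (x (n + 1)) - realObjective F R xs) +
      L / 2 * ‖T n • x (n + 1) - (T n - 1) • x n - xs‖ ^ 2 ≤ L / 2 * ‖x 0 - xs‖ ^ 2 by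
    have : 0 ≤ L / 2 * ‖T n • x (n + 1) - (T n - 1) • x n - xs‖ ^ 2 := by positivity
    linarith
  induction n with
  | zero =>
    have h := forwardBackward_inequality hL hRp hRc hFc hF hlip (hx.x_succ 0) hxs'
    rw [hx.y_zero, norm_sub_rev xs, norm_sub_rev xs] at h
    simp only [hT0, sub_self, zero_smul, sub_zero, one_smul, one_pow, one_mul, zero_add]
    linarith
  | succ n ih =>
    have h1 := hx.energy_succ_le hL hRp hRc hFc hF hlip hT ha hxs' n
    have h2 := mul_le_mul_of_nonneg_right (hTT n) (sub_nonneg.2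
      (realObjective_le_of_mem_minimizers hRp hxs
        ((hx.x_succ n).ne_top (one_div_pos.2 hL) hRp)))
    linarith

/-- The forward-backward inequality at the comparison point `u = x (n + 1)`. -/
lemma gap_add_sq_step_le (hx : IsInertialFB F R (1 / L) a x y) (hL : 0 < L)
    (hRp : ProperFun R) (hRc : ConvexFun R) (hFc : ConvexOn ℝ Set.univ F)
    (hF : Differentiable ℝ F) (hlip : ∀ u v, ‖gradient F u - gradient F v‖ ≤ L * ‖u - v‖)
    (n : ℕ) :
    realObjective F R (x (n + 2)) + L / 2 * ‖x (n + 2) - x (n + 1)‖ ^ 2 ≤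
      realObjective F R (x (n + 1)) + a (n + 1) ^ 2 * (L / 2 * ‖x (n + 1) - x n‖ ^ 2) := by
  have h := forwardBackward_inequality hL hRp hRc hFc hF hlip (hx.x_succ (n + 1))
    ((hx.x_succ n).ne_top (one_div_pos.2 hL) hRp)
  rw [hx.y_succ, sub_add_cancel_left, norm_neg, norm_smul, mul_pow, Real.norm_eq_abs, sq_abs,
    norm_sub_rev] at h
  linarith

/-- The rates in terms of `T`, and the first hypothesis of Opial's lemma. -/
theorem tendsto_sq_mul_gap (hx : IsInertialFB F R (1 / L) a x y) (hL : 0 < L)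
    (hRp : ProperFun R) (hRc : ConvexFun R) (hFc : ConvexOn ℝ Set.univ F)
    (hF : Differentiable ℝ F) (hlip : ∀ u v, ‖gradient F u - gradient F v‖ ≤ L * ‖u - v‖)
    {δ C : ℝ} (hδ : 0 < δ) (hT : ∀ n, 1 ≤ T n) (hT_mono : Monotone T)
    (hTC : ∀ n, T n ≤ C * (n + 1))
    (hTδ : ∀ n, T (n + 1) ^ 2 - T (n + 1) + δ * T (n + 1) ≤ T n ^ 2)
    (ha : ∀ n, a (n + 1) = (T n - 1) / T (n + 1)) (hxs : xs ∈ minimizers (objective F R)) :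
    Tendsto (fun n => T n ^ 2 * (realObjective F R (x (n + 1)) - realObjective F R xs))
        atTop (𝓝 0) ∧
      Tendsto (fun n => T n * ‖x (n + 1) - x n‖) atTop (𝓝 0) ∧
      ∃ l, Tendsto (fun n => ‖x (n + 1) - xs‖) atTop (𝓝 l) := by
  have hxs' := ne_top_of_mem_minimizers hRp hxs
  obtain ⟨h1, h2, l, h3⟩ := tendsto_zero_of_inertial_inequalities
    (W := fun n => realObjective F R (x (n + 1)) - realObjective F R xs)
    (D := fun n => L / 2 * ‖x (n + 1) - x n‖ ^ 2)
    (V := fun n => L / 2 * ‖T n • x (n + 1) - (T n - 1) • x n - xs‖ ^ 2)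
    hδ hT hT_mono hTC hTδ
    (fun n => sub_nonneg.2 (realObjective_le_of_mem_minimizers hRp hxs
      ((hx.x_succ n).ne_top (one_div_pos.2 hL) hRp)))
    (fun n => by positivity) (fun n => by positivity)
    (hx.energy_succ_le hL hRp hRc hFc hF hlip hT ha hxs')
    (fun n => by
      have h := hx.gap_add_sq_step_le hL hRp hRc hFc hF hlip n
      rw [ha] at h
      linarith)
  have h4 : Tendsto (fun n => T n * ‖x (n + 1) - x n‖) atTop (𝓝 0) := by
    have h := (h2.const_mul (2 / L)).sqrt
    rw [mul_zero, Real.sqrt_zero] at h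
    refine h.congr fun n => ?_
    rw [← Real.sqrt_sq (mul_nonneg (one_pos.trans_le (hT n)).le (norm_nonneg (x (n + 1) - x n)))]
    congr 1
    field_simp
  refine ⟨h1, h4, √(2 / L * l), ?_⟩
  have h5 : Tendsto (fun n => ‖T n • x (n + 1) - (T n - 1) • x n - xs‖) atTop
      (𝓝 √(2 / L * l)) := by
    refine (h3.const_mul (2 / L)).sqrt.congr fun n => ?_
    rw [← Real.sqrt_sq (norm_nonneg (T n • x (n + 1) - (T n - 1) • x n - xs))]
    congr 1
    rw [Real.sqrt_sq (norm_nonneg _)]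
    field_simp
  -- The energy vector differs from `x (n + 1) - xs` by `(T n - 1) • (x (n + 1) - x n)`, which tends
  -- to zero by `h4`.
  refine tendsto_of_tendsto_of_dist h5 (squeeze_zero (fun _ => dist_nonneg) (fun n => ?_) h4)
  have h6 : T n • x (n + 1) - (T n - 1) • x n - xs - (x (n + 1) - xs) =
      (T n - 1) • (x (n + 1) - x n) := by module
  rw [Real.dist_eq]
  refine (abs_norm_sub_norm_le _ _).trans ?_
  rw [h6, norm_smul, Real.norm_of_nonneg (sub_nonneg.2 (hT n))]
  exact mul_le_mul_of_nonneg_right (by linarith) (norm_nonneg _)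

/-- The `o(1/k²)` and `o(1/k)` rates and weak convergence, for momentum built on a linearly growing
sequence `T` that satisfies the recurrence with some slack `δ > 0`. -/
theorem convergence (hx : IsInertialFB F R (1 / L) a x y) (hL : 0 < L)
    (hRp : ProperFun R) (hRc : ConvexFun R) (hRl : LowerSemicontinuous R)
    (hFc : ConvexOn ℝ Set.univ F)
    (hF : Differentiable ℝ F) (hlip : ∀ u v, ‖gradient F u - gradient F v‖ ≤ L * ‖u - v‖)
    (hmin : (minimizers (objective F R)).Nonempty)
    {δ c C : ℝ} (hδ : 0 < δ) (hT : ∀ n, 1 ≤ T n) (hT_mono : Monotone T) (hc : 0 < c)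
    (hTc : ∀ n, c * (n + 1) ≤ T n) (hTC : ∀ n, T n ≤ C * (n + 1))
    (hTδ : ∀ n, T (n + 1) ^ 2 - T (n + 1) + δ * T (n + 1) ≤ T n ^ 2)
    (ha : ∀ n, a (n + 1) = (T n - 1) / T (n + 1)) :
    (∀ k : ℕ, 1 ≤ k → objective F R (x k) ≠ ⊤) ∧
    (∀ xs ∈ minimizers (objective F R),
      (fun k : ℕ => (objective F R (x k) - objective F R xs).toReal)
        =o[atTop] fun k : ℕ => 1 / (k : ℝ) ^ 2) ∧
    (∃ xs ∈ minimizers (objective F R),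
      Tendsto (fun k => toWeakSpace ℝ H (x k)) atTop (𝓝 (toWeakSpace ℝ H xs))) ∧
    (fun k : ℕ => ‖x (k + 1) - x k‖) =o[atTop] fun k : ℕ => 1 / ((k : ℝ) + 1) := by
  have hdom : ∀ n, R (x (n + 1)) ≠ ⊤ := fun n => (hx.x_succ n).ne_top (one_div_pos.2 hL) hRp
  have hmain := fun (xs : H) (hxs : xs ∈ minimizers (objective F R)) =>
    hx.tendsto_sq_mul_gap hL hRp hRc hFc hF hlip hδ hT hT_mono hTC hTδ ha hxs
  have hgap : ∀ xs ∈ minimizers (objective F R), ∀ n,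
      0 ≤ realObjective F R (x (n + 1)) - realObjective F R xs := fun xs hxs n =>
    sub_nonneg.2 (realObjective_le_of_mem_minimizers hRp hxs (hdom n))
  refine ⟨fun k hk => ?_, fun xs hxs => ?_, ?_, ?_⟩
  · obtain ⟨n, rfl⟩ := Nat.exists_eq_add_of_le' hk
    rw [objective_eq_coe hRp (hdom n)]
    exact EReal.coe_ne_top _
  · rw [isLittleO_iff_tendsto' (by
      filter_upwards [eventually_ge_atTop 1] with k hk h
      have hk' : (0 : ℝ) < k := Nat.cast_pos.2 hk
      exact absurd h (by positivity)), ← tendsto_add_atTop_iff_nat 1]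
    have h := (hmain xs hxs).1.const_mul (1 / c ^ 2)
    rw [mul_zero] at h
    refine squeeze_zero (fun n => ?_) (fun n => ?_) h
    all_goals
      rw [objective_eq_coe hRp (hdom n), objective_eq_coe hRp (ne_top_of_mem_minimizers hRp hxs),
        ← EReal.coe_sub, EReal.toReal_coe]
    · exact div_nonneg (hgap xs hxs n) (by positivity)
    · have h1 : (c * ((n : ℝ) + 1)) ^ 2 ≤ T n ^ 2 := by
        have := hTc n
        gcongr
      have h2 := mul_le_mul_of_nonneg_right h1 (hgap xs hxs n)
      rw [div_div_eq_mul_div, div_one, one_div_mul_eq_div, le_div_iff₀ (by positivity)]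
      push_cast
      linarith
  · obtain ⟨z, hz, hzl⟩ := exists_weak_limit_of_opial (x := fun n => x (n + 1)) hmin
      (fun s hs => (hmain s hs).2.2) (fun U z hU hz => by
        obtain ⟨xs, hxs⟩ := hmin
        have hxs' := ne_top_of_mem_minimizers hRp hxs
        have hW : Tendsto (fun n => realObjective F R (x (n + 1)) - realObjective F R xs)
            atTop (𝓝 0) :=
          squeeze_zero (hgap xs hxs)
            (fun n => le_mul_of_one_le_left (hgap xs hxs n) (one_le_pow₀ (hT n)))
            (hmain xs hxs).1
        have hsub : ∀ ε > 0, objective F R z ≤ ((realObjective F R xs + ε : ℝ) : EReal) := by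
          intro ε hε
          refine mem_of_tendsto_inner (l := (U : Filter ℕ)) (x := fun n => x (n + 1))
            (convex_sublevel hFc hRc hRp _) (isClosed_sublevel hF.continuous hRl _)
            (hU ?_) hz
          filter_upwards [hW.eventually (gt_mem_nhds hε)] with n hn
          rw [objective_eq_coe hRp (hdom n), EReal.coe_le_coe_iff]
          linarith
        have hzt : R z ≠ ⊤ := ne_top_of_le_ne_top (EReal.coe_ne_top _)
          (objective_le_coe_iff.1 (hsub 1 one_pos))
        intro u
        refine le_trans ?_ (hxs u)
        rw [objective_eq_coe hRp hzt, objective_eq_coe hRp hxs', EReal.coe_le_coe_iff]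
        refine le_of_forall_pos_le_add fun ε hε => ?_
        have h := hsub ε hε
        rwa [objective_eq_coe hRp hzt, EReal.coe_le_coe_iff] at h)
    exact ⟨z, hz, (tendsto_add_atTop_iff_nat 1).1 hzl⟩
  · obtain ⟨xs, hxs⟩ := hmin
    rw [isLittleO_iff_tendsto fun n h => absurd h (by positivity)]
    have h := (hmain xs hxs).2.1.const_mul (1 / c)
    rw [mul_zero] at h
    refine squeeze_zero (fun n => by positivity) (fun n => ?_) h
    rw [div_div_eq_mul_div, div_one, one_div_mul_eq_div, le_div_iff₀ hc]
    have := mul_le_mul_of_nonneg_right (hTc n) (norm_nonneg (x (n + 1) - x n))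
    linarith

end IsInertialFB

end Hilbert

/-! ### The parameter sequences -/

section Parameters

/-- The terms stay positive, since `θ (k + 1) = 0` would force `θ k = 0`. -/
lemma pos_of_apg_recurrence {σ : ℝ} {θ : ℕ → ℝ} (h0 : 0 < θ 0) (hnn : ∀ k, 0 ≤ θ k)
    (h : ∀ k, θ (k + 1) ^ 2 = (1 - σ * θ (k + 1)) * θ k ^ 2 + 0 * θ (k + 1)) (k : ℕ) :
    0 < θ k := by
  induction k with
  | zero => exact h0
  | succ k ih =>
    refine (hnn _).lt_of_ne' fun h' => ?_
    have := h k
    rw [h'] at this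
    nlinarith [pow_pos ih 2]

lemma apg_recurrence_iff {σ s s' : ℝ} (hs : 0 < s) (hs' : 0 < s') :
    s' ^ 2 = (1 - σ * s') * s ^ 2 + 0 * s' ↔
      (1 / s') ^ 2 - σ * (1 / s') = (1 / s) ^ 2 := by
  field_simp
  constructor <;> intro h <;> linarith

lemma eq_half_add_sqrt_iff {σ t t' : ℝ} (hσ : 0 < σ) (ht' : 0 < t') :
    t' = (σ + √(σ ^ 2 + 4 * t ^ 2)) / 2 ↔ t' ^ 2 - σ * t' = t ^ 2 := by
  have hnn : 0 ≤ σ ^ 2 + 4 * t ^ 2 := by positivity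
  constructor
  · intro h
    have h1 : √(σ ^ 2 + 4 * t ^ 2) = 2 * t' - σ := by linarith
    have h2 := Real.sq_sqrt hnn
    rw [h1] at h2
    linarith
  · intro h
    have h1 : σ ^ 2 + 4 * t ^ 2 = (2 * t' - σ) ^ 2 := by rw [← h]; ring
    have h2 : 0 ≤ 2 * t' - σ := by nlinarith [sq_nonneg t]
    rw [h1, Real.sqrt_sq h2]
    ring

/-- The recurrence says `s' = (1 / s' - σ) * s ^ 2`, so the momentum denominator is
`(1 / s' + (κ - σ)) * s ^ 2`. -/
lemma apg_momentum_eq {σ κ s s' : ℝ} (hs : 0 < s) (hs' : 0 < s') (hκ : 0 < κ)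
    (h : s' ^ 2 = (1 - σ * s') * s ^ 2 + 0 * s') :
    s * (1 - s) / (κ * s ^ 2 + s') = (1 / s - 1) / (1 / s' + (κ - σ)) := by
  have h1 : 0 < κ * s ^ 2 + s' := by positivity
  have h2 : (1 / s' + (κ - σ)) * s ^ 2 = κ * s ^ 2 + s' := by
    field_simp
    linarith
  have h3 : 0 < 1 / s' + (κ - σ) := pos_of_mul_pos_left (h2 ▸ h1) (sq_nonneg s)
  rw [div_eq_div_iff h1.ne' h3.ne', ← h2]
  field_simp

lemma add_half_le_and_le_add_of_recurrence {σ t t' : ℝ} (hσ : 0 < σ) (ht : 0 < t) (ht' : 0 < t')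
    (h : t' ^ 2 - σ * t' = t ^ 2) : t + σ / 2 ≤ t' ∧ t' ≤ t + σ := by
  have h1 : σ < t' := by nlinarith [pow_pos ht 2]
  constructor
  · have h2 : t ^ 2 ≤ (t' - σ / 2) ^ 2 := by nlinarith [sq_nonneg σ]
    linarith [(sq_le_sq₀ ht.le (by linarith)).1 h2]
  · nlinarith

end Parameters

/-! ### The modified APG scheme -/

section Hilbert

variable {H : Type*} [NormedAddCommGroup H] [InnerProductSpace ℝ H] [CompleteSpace H]
  {F : H → ℝ} {R : H → EReal} {L σ κ θ₀ : ℝ} {θ a : ℕ → ℝ} {x y : ℕ → H}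

theorem isMAPG_iff_isFISTAMod (hσ : 0 < σ) (hθ₀ : 0 < θ₀) :
    IsMAPG F R L σ 0 σ θ₀ θ a x y ↔
      IsFISTAMod F R (1 / L) σ (σ ^ 2) 4 (1 / θ₀) (fun k => 1 / θ k) a x y := by
  have hmom : ∀ {s s' : ℝ}, 0 < s → 0 < s' → s' ^ 2 = (1 - σ * s') * s ^ 2 + 0 * s' →
      s * (1 - s) / (σ * s ^ 2 + s') = (1 / s - 1) / (1 / s') := fun hs hs' h => by
    rw [apg_momentum_eq hs hs' hσ h, sub_self, add_zero]
  constructor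
  · intro h
    have hpos := pos_of_apg_recurrence (h.θ_zero ▸ hθ₀) h.θ_nonneg h.θ_succ
    refine ⟨by rw [h.θ_zero], fun k => ?_, fun k => ?_, h.iter⟩
    · exact (eq_half_add_sqrt_iff hσ (one_div_pos.2 (hpos _))).2
        ((apg_recurrence_iff (hpos k) (hpos (k + 1))).1 (h.θ_succ k))
    · rw [h.a_succ, hmom (hpos k) (hpos (k + 1)) (h.θ_succ k)]
  · intro h
    have h0 : θ 0 = θ₀ := by simpa using h.t_zero
    have hpos : ∀ k, 0 < θ k := by
      intro k
      rcases k with _ | k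
      · exact h0 ▸ hθ₀
      · have := h.t_succ k
        exact one_div_pos.1 (this ▸ by positivity)
    have hsucc : ∀ k, θ (k + 1) ^ 2 = (1 - σ * θ (k + 1)) * θ k ^ 2 + 0 * θ (k + 1) := fun k =>
      (apg_recurrence_iff (hpos k) (hpos (k + 1))).2
        ((eq_half_add_sqrt_iff hσ (one_div_pos.2 (hpos _))).1 (h.t_succ k))
    refine ⟨h0, fun k => (hpos k).le, hsucc, fun k => ?_, h.iter⟩
    rw [hmom (hpos k) (hpos (k + 1)) (hsucc k)]
    exact h.a_succ k

/-- Both momentum formulas have the form `(T k - 1) / T (k + 1)`, with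
`T k = (1 / θ k + κ - σ) / (1 + κ - σ)`. The slack in the recurrence for `T` is positive exactly
when `σ < 1`. -/
theorem IsMAPG.exists_momentum (h : IsMAPG F R L σ 0 κ θ₀ θ a x y) (hσ : 0 < σ) (hσκ : σ ≤ κ)
    (hκ : κ ≤ 1) (hθ₀ : 0 < θ₀) (hθ₀' : θ₀ ≤ 1) :
    ∃ T : ℕ → ℝ, T 0 = (1 / θ₀ + (κ - σ)) / (1 + κ - σ) ∧ (∀ n, 1 ≤ T n) ∧ Monotone T ∧
      (∀ n : ℕ, σ * (n + 2) / (2 * (1 + κ - σ)) ≤ T n) ∧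
      (∀ n : ℕ, T n ≤ 1 / θ₀ * (n + 1)) ∧
      (∀ n, T (n + 1) ^ 2 - T (n + 1) + (1 - σ) / (1 + κ - σ) ^ 2 * T (n + 1) ≤ T n ^ 2) ∧
      (∀ n, a (n + 1) = (T n - 1) / T (n + 1)) := by
  have hpos := pos_of_apg_recurrence (h.θ_zero ▸ hθ₀) h.θ_nonneg h.θ_succ
  obtain ⟨t, ht⟩ : ∃ t : ℕ → ℝ, ∀ n, t n = 1 / θ n := ⟨_, fun _ => rfl⟩
  obtain ⟨c, hc⟩ : ∃ c, c = κ - σ := ⟨_, rfl⟩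
  have hc0 : 0 ≤ c := by linarith
  have htpos : ∀ n, 0 < t n := fun n => by rw [ht]; exact one_div_pos.2 (hpos n)
  have hrec : ∀ n, t (n + 1) ^ 2 - σ * t (n + 1) = t n ^ 2 := fun n => by
    rw [ht, ht]
    exact (apg_recurrence_iff (hpos n) (hpos (n + 1))).1 (h.θ_succ n)
  have hgr := fun n => add_half_le_and_le_add_of_recurrence hσ (htpos n) (htpos (n + 1)) (hrec n)
  have ht0 : t 0 = 1 / θ₀ := by rw [ht, h.θ_zero]
  have ht0' : 1 ≤ t 0 := by rw [ht0]; exact (one_le_div hθ₀).2 hθ₀'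
  -- Both growth bounds follow from `t n + σ / 2 ≤ t (n + 1) ≤ t n + σ`.
  have hlow : ∀ n : ℕ, 1 + σ * n / 2 ≤ t n := by
    intro n
    induction n with
    | zero => simpa using ht0'
    | succ n ih => push_cast; linarith [(hgr n).1]
  have hup : ∀ n : ℕ, t n ≤ t 0 + σ * n := by
    intro n
    induction n with
    | zero => simp
    | succ n ih => push_cast; linarith [(hgr n).2]
  have ht1 : ∀ n, 1 ≤ t n := fun n => le_trans (le_add_of_nonneg_right (by positivity)) (hlow n)
  have hden : 0 < 1 + c := by linarith
  have hTle : ∀ n, (t n + c) / (1 + c) ≤ t n := fun n => by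
    rw [div_le_iff₀ hden]
    nlinarith [ht1 n]
  rw [add_sub_assoc, ← hc]
  refine ⟨fun n => (t n + c) / (1 + c), by simp only [ht0], fun n => ?_, ?_, fun n => ?_,
    fun n => ?_, fun n => ?_, fun n => ?_⟩
  · rw [one_le_div hden]
    linarith [ht1 n]
  · refine monotone_nat_of_le_succ fun n => ?_
    have := (hgr n).1
    gcongr
    linarith
  · rw [div_le_div_iff₀ (by positivity) hden]
    have : σ * (n + 2) ≤ 2 * (t n + c) := by linarith [hlow n]
    nlinarith
  · refine (hTle n).trans ((hup n).trans ?_)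
    rw [← ht0]
    have : σ * n ≤ t 0 * n := mul_le_mul_of_nonneg_right (by linarith) n.cast_nonneg
    linarith
  · have h1 := (hgr n).2
    have h2 := hTle (n + 1)
    have h3 := ht1 n
    have h4 : (1 - σ) / (1 + c) ^ 2 * ((t (n + 1) + c) / (1 + c)) ≤
        (1 - σ) / (1 + c) ^ 2 * t (n + 1) :=
      mul_le_mul_of_nonneg_left h2 (div_nonneg (by linarith) (sq_nonneg _))
    have h5 : ((t (n + 1) + c) / (1 + c)) ^ 2 - (t (n + 1) + c) / (1 + c) +
        (1 - σ) / (1 + c) ^ 2 * t (n + 1) ≤ ((t n + c) / (1 + c)) ^ 2 := by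
      have h6 : ((t (n + 1) + c) / (1 + c)) ^ 2 - (t (n + 1) + c) / (1 + c) +
          (1 - σ) / (1 + c) ^ 2 * t (n + 1) =
          ((t (n + 1) + c) ^ 2 - (t (n + 1) + c) * (1 + c) + (1 - σ) * t (n + 1)) /
            (1 + c) ^ 2 := by
        field_simp
      rw [h6, div_pow]
      gcongr
      have h7 : c * t (n + 1) ≤ c * (2 * t n) := mul_le_mul_of_nonneg_left (by linarith) hc0
      nlinarith [hrec n]
    linarith
  · rw [h.a_succ, apg_momentum_eq (hpos n) (hpos (n + 1)) (hσ.trans_le hσκ) (h.θ_succ n),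
      ← ht, ← ht, ← hc, div_sub_one hden.ne', div_div_div_cancel_right₀ hden.ne']
    congr 1
    ring

/-- The `O(1/k²)` bound for every momentum weight `κ ∈ [σ, 1]`; the constants for `κ = σ` and
`κ = 1` are `2 L` and `2 L (2 - σ)²`. -/
theorem IsMAPG.objective_sub_le (h : IsMAPG F R L σ 0 κ 1 θ a x y) (hL : 0 < L)
    (hRp : ProperFun R) (hRc : ConvexFun R) (hFc : ConvexOn ℝ Set.univ F)
    (hF : Differentiable ℝ F) (hlip : ∀ u v, ‖gradient F u - gradient F v‖ ≤ L * ‖u - v‖)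
    (hσ : 0 < σ) (hσκ : σ ≤ κ) (hκ : κ ≤ 1) {xs : H} (hxs : xs ∈ minimizers (objective F R))
    {k : ℕ} (hk : 1 ≤ k) :
    objective F R (x k) - objective F R xs ≤
      ((2 * L * (1 + κ - σ) ^ 2 / (σ ^ 2 * ((k : ℝ) + 1) ^ 2) * ‖x 0 - xs‖ ^ 2 : ℝ) : EReal) := by
  obtain ⟨n, rfl⟩ := Nat.exists_eq_add_of_le' hk
  obtain ⟨T, hT0, hT, -, hTc, -, hTδ, ha⟩ := h.exists_momentum hσ hσκ hκ one_pos le_rfl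
  have hden : 0 < 1 + κ - σ := by linarith
  rw [one_div_one, ← add_sub_assoc, div_self hden.ne'] at hT0
  have hTT : ∀ n, T (n + 1) ^ 2 - T (n + 1) ≤ T n ^ 2 := fun n =>
    (le_add_of_nonneg_right (mul_nonneg (div_nonneg (by linarith) (sq_nonneg _))
      (zero_le_one.trans (hT (n + 1))))).trans (hTδ n)
  have h1 := h.iter.sq_mul_gap_le hL hRp hRc hFc hF hlip hT hT0 hTT ha hxs n
  have hdom := (h.iter.x_succ n).ne_top (one_div_pos.2 hL) hRp
  have hgap := sub_nonneg.2 (realObjective_le_of_mem_minimizers hRp hxs hdom)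
  rw [objective_eq_coe hRp hdom, objective_eq_coe hRp (ne_top_of_mem_minimizers hRp hxs),
    ← EReal.coe_sub, EReal.coe_le_coe_iff]
  have h2 : (σ * (n + 2) / (2 * (1 + κ - σ))) ^ 2 ≤ T n ^ 2 := by
    have := hTc n
    gcongr
  have h3 := (mul_le_mul_of_nonneg_right h2 hgap).trans h1
  rw [mul_comm, ← le_div_iff₀ (by positivity)] at h3
  refine h3.trans_eq ?_
  push_cast
  field_simp
  ring

end Hilbert

theorem mainTheorem3 {H : Type*} [NormedAddCommGroup H] [InnerProductSpace ℝ H] [CompleteSpace H]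
    (F : H → ℝ) (R : H → EReal) (L : ℝ) (hL : 0 < L)
    (hR_proper : ProperFun R) (hR_convex : ConvexFun R) (hR_lsc : LowerSemicontinuous R)
    (hF_convex : ConvexOn ℝ Set.univ F) (hF_diff : Differentiable ℝ F)
    (hF_lip : ∀ u v, ‖gradient F u - gradient F v‖ ≤ L * ‖u - v‖)
    (hmin : (minimizers (objective F R)).Nonempty)
    (σ : ℝ) (hσ_pos : 0 < σ) (hσ_le : σ ≤ 1) :
    -- the scheme is FISTA-Mod with `p = σ`, `q = σ²`, `r = 4` under `t_k = 1 / θ_k`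
    (∀ θ₀ : ℝ, 0 < θ₀ → θ₀ ≤ 1 → ∀ (θ a : ℕ → ℝ) (x y : ℕ → H),
      IsMAPG F R L σ 0 σ θ₀ θ a x y ↔
        IsFISTAMod F R (1 / L) σ (σ ^ 2) 4 (1 / θ₀) (fun k => 1 / θ k) a x y) ∧
    -- the `O(1/k²)` bound
    (∀ (θ a : ℕ → ℝ) (x y : ℕ → H), IsMAPG F R L σ 0 σ 1 θ a x y →
      ∀ xs ∈ minimizers (objective F R), ∀ k : ℕ, 1 ≤ k →
        objective F R (x k) - objective F R xs ≤
          ((2 * L / (σ ^ 2 * ((k : ℝ) + 1) ^ 2) * ‖x 0 - xs‖ ^ 2 : ℝ) : EReal)) ∧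
    -- the same with the momentum formula of the unmodified APG
    (∀ (θ a : ℕ → ℝ) (x y : ℕ → H), IsMAPG F R L σ 0 1 1 θ a x y →
      ∀ xs ∈ minimizers (objective F R), ∀ k : ℕ, 1 ≤ k →
        objective F R (x k) - objective F R xs ≤
          ((2 * L * (2 - σ) ^ 2 / (σ ^ 2 * ((k : ℝ) + 1) ^ 2) * ‖x 0 - xs‖ ^ 2 : ℝ) : EReal)) ∧
    -- the case `σ < 1`, for both momentum formulas
    (σ < 1 → ∀ κ : ℝ, κ = σ ∨ κ = 1 → ∀ θ₀ : ℝ, 0 < θ₀ → θ₀ ≤ 1 →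
      ∀ (θ a : ℕ → ℝ) (x y : ℕ → H), IsMAPG F R L σ 0 κ θ₀ θ a x y →
        (∀ k : ℕ, 1 ≤ k → objective F R (x k) ≠ ⊤) ∧
        (∀ xs ∈ minimizers (objective F R),
          (fun k : ℕ => (objective F R (x k) - objective F R xs).toReal)
            =o[atTop] fun k : ℕ => 1 / (k : ℝ) ^ 2) ∧
        (∃ xs ∈ minimizers (objective F R),
          Tendsto (fun k => toWeakSpace ℝ H (x k)) atTop (𝓝 (toWeakSpace ℝ H xs))) ∧
        (fun k : ℕ => ‖x (k + 1) - x k‖) =o[atTop] fun k : ℕ => 1 / ((k : ℝ) + 1)) := by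
  refine ⟨fun θ₀ hθ₀ _ θ a x y => isMAPG_iff_isFISTAMod hσ_pos hθ₀, ?_, ?_, ?_⟩
  · intro θ a x y h xs hxs k hk
    have := h.objective_sub_le hL hR_proper hR_convex hF_convex hF_diff hF_lip hσ_pos le_rfl
      hσ_le hxs hk
    rwa [add_sub_cancel_right, one_pow, mul_one] at this
  · intro θ a x y h xs hxs k hk
    have := h.objective_sub_le hL hR_proper hR_convex hF_convex hF_diff hF_lip hσ_pos hσ_le
      le_rfl hxs hk
    rwa [one_add_one_eq_two] at this
  · intro hσ_lt κ hκ θ₀ hθ₀ hθ₀' θ a x y h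
    have hσκ : σ ≤ κ := by rcases hκ with rfl | rfl <;> linarith
    have hκ1 : κ ≤ 1 := by rcases hκ with rfl | rfl <;> linarith
    obtain ⟨T, -, hT, hT_mono, hTc, hTC, hTδ, ha⟩ :=
      h.exists_momentum hσ_pos hσκ hκ1 hθ₀ hθ₀'
    have hden : 0 < 1 + κ - σ := by linarith
    refine h.iter.convergence hL hR_proper hR_convex hR_lsc hF_convex hF_diff hF_lip hmin
      (div_pos (sub_pos.2 hσ_lt) (pow_pos hden 2)) hT hT_mono
      (c := σ / (2 * (1 + κ - σ))) (by positivity) (fun n => le_trans ?_ (hTc n)) hTC hTδ ha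
    rw [div_mul_eq_mul_div]
    gcongr
    norm_num
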